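/- Let $d \ge 0$ be an integer and let $\Delta_d = \{x \in \mathbb{R}^{d+1} : x_i \ge 0 \text{ for all } i,\ \sum_{i=0}^d x_i = 1\}$ be the standard $d$-simplex, with vertices indexed by $0,\dots,d$. For $I \subseteq \{0,\dots,d\}$, the face of $\Delta_d$ determined by $I$ is the set of all $x \in \Delta_d$ with $x_i = 0$ for every $i \notin I$. A KKM cover of $\Delta_d$ is a family of closed sets $C_0,\dots,C_d \subseteq \Delta_d$ such that, for every $I \subseteq \{0,\dots,d\}$, the face of $\Delta_d$ determined by $I$ is contained in $\bigcup_{i \in I} C_i$. **Theorem (Strong colorful KKM theorem).** Let $\{C^1_i\}_{i=0,\dots,d}, \dots, \{C^d_i\}_{i=0,\dots,d}$ be $d$ KKM covers of $\Delta_d$. Then there are a point $x \in \Delta_d$ and $d+1$ bijections $\pi_i \colon \{1,\dots,d\} \to \{0,\dots,d\}\setminus\{i\}$, $i \in \{0,\dots,d\}$, such that for every $i \in \{0,\dots,d\}$ we have $$x \in C^1_{\pi_i(1)} \cap \dots \cap C^d_{\pi_i(d)}.$$ -/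

import Mathlib

/-- The face of the standard `d`-simplex determined by a set `I` of vertices: the points of the
simplex whose barycentric coordinates outside `I` vanish (the convex hull of the vertices
in `I`). -/
def simplexFace (d : ℕ) (I : Set (Fin (d + 1))) : Set (Fin (d + 1) → ℝ) :=
  {x | x ∈ stdSimplex ℝ (Fin (d + 1)) ∧ ∀ i, i ∉ I → x i = 0}

/-- A KKM cover of the standard `d`-simplex: closed subsets `C 0, …, C d` of the simplex such that
for every set `I` of vertices the face determined by `I` is covered by the `C i` with `i ∈ I`. -/
structure IsKKMCover {d : ℕ} (C : Fin (d + 1) → Set (Fin (d + 1) → ℝ)) : Prop where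
  isClosed : ∀ i, IsClosed (C i)
  subset_simplex : ∀ i, C i ⊆ stdSimplex ℝ (Fin (d + 1))
  face_subset : ∀ I : Set (Fin (d + 1)), simplexFace d I ⊆ ⋃ i ∈ I, C i

/-!
A KKM cover `C` is replaced by a continuous self-map `f` of the simplex that preserves every face and
whose `k`-th coordinate vanishes away from the `ε`-neighborhood of `C k`
(`IsKKMCover.exists_partition`): normalize the functions `x k * max 0 (ε - infDist x (C k))`. For
the `d` given covers, the values `f j x k` form a `d × (d + 1)` matrix with row sums `1`. If all its
column sums are less than `1`, then any nonempty set of rows meets more columns than it has rows, so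
Hall's marriage theorem matches the rows with the columns other than any prescribed one
(`exists_equiv_pos_of_sum_lt_one`). This yields the bijections up to `ε`, and compactness together
with the finiteness of the set of families of bijections removes the `ε`.

It remains to find a point at which all column sums are less than `1`. The closed sets where the
`k`-th column sum is at most its average `d / (d + 1)` cover the simplex. By
`exists_mem_face_of_closed_cover` some point `x` lies in the sets indexed by `S` and has zero
coordinates outside `S`; the columns outside `S` then vanish because faces are preserved.

That covering lemma, equivalent in strength to Brouwer's fixed point theorem, is derived from
Scarf's lemma (`IsSlack.exists_rainbow`) applied to a finite dense set of points ordered by each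
coordinate. Its proof is a parity argument in the style of Sperner's lemma, in which dominant sets
play the role of the simplices of a triangulation: sets with one element fewer lie in an even number
of them (`even_card_dominant_insert`), except for a single set of slack elements, which lies in
one (`card_dominant_insert_slack`).
-/

/-! ### Scarf's combinatorial lemma -/

section Scarf

open scoped Classical
open Finset Function

variable {I X L : Type*} [LinearOrder L]

/-- A set `S` is dominant for the order functions `v i` if no element is strictly above all of `S`
with respect to every one of them. -/
def IsDominant (v : I → X → L) (S : Finset X) : Prop :=
  ∀ t, ∃ i, ∀ s ∈ S, v i t ≤ v i s

/-- The functions `v i` linearly order `X`, and `e i` are slack elements: `e i` is the least element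
for `v i`, while the other `e j` lie above every element that is not slack. -/
structure IsSlack (v : I → X → L) (e : I → X) : Prop where
  inj : ∀ i, Injective (v i)
  bot : ∀ i x, x ≠ e i → v i (e i) < v i x
  top : ∀ i j x, j ≠ i → (∀ k, x ≠ e k) → v i x < v i (e j)

theorem IsDominant.mono {v : I → X → L} {S S' : Finset X} (h : IsDominant v S) (hS : S' ⊆ S) :
    IsDominant v S' := fun t => by
  obtain ⟨i, hi⟩ := h t
  exact ⟨i, fun s hs => hi s (hS hs)⟩

/-- Every element of a dominant set is its least element for one of the orders. -/
theorem IsDominant.exists_isLeast {v : I → X → L} (hv : ∀ i, Injective (v i)) {S : Finset X}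
    (h : IsDominant v S) {m : I → X} (hmS : ∀ i, m i ∈ S) (hm : ∀ i, ∀ s ∈ S, v i (m i) ≤ v i s)
    {s : X} (hs : s ∈ S) : ∃ i, m i = s := by
  obtain ⟨i, hi⟩ := h s
  exact ⟨i, hv i (le_antisymm (hm i s hs) (hi _ (hmS i)))⟩

variable [Fintype I]

/-- For a dominant set `τ` with one element fewer than there are orders, exactly two orders `a`, `b`
share their least element. -/
theorem IsDominant.exists_pair {v : I → X → L} (hv : ∀ i, Injective (v i)) {τ : Finset X}
    (h : IsDominant v τ) (hcard : #τ + 1 = Fintype.card I) {m : I → X}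
    (hmS : ∀ i, m i ∈ τ) (hm : ∀ i, ∀ s ∈ τ, v i (m i) ≤ v i s) :
    ∃ a b, a ≠ b ∧ m a = m b ∧ (∀ k, k = a ∨ k = b → ∀ s ∈ τ, ∃ l, l ≠ k ∧ m l = s) := by
  obtain ⟨a, -, b, -, hab, hmab⟩ :=
    exists_ne_map_eq_of_card_lt_of_maps_to (s := (univ : Finset I)) (t := τ) (f := m)
      (by rw [card_univ]; omega) (fun i _ => hmS i)
  refine ⟨a, b, hab, hmab, ?_⟩
  rintro k hk s hs
  obtain ⟨l, rfl⟩ := h.exists_isLeast hv hmS hm hs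
  by_cases hl : l = k
  · subst hl
    rcases hk with rfl | rfl
    · exact ⟨b, hab.symm, hmab.symm⟩
    · exact ⟨a, hab, hmab⟩
  · exact ⟨l, hl, rfl⟩

/-- Adding `x` to `τ` keeps it dominant exactly if, for one of the two orders `k` that share their
least element, `x` is the greatest for `v k` among the elements above the least elements of `τ` in
all other orders. -/
theorem isDominant_insert_iff {v : I → X → L} (hv : ∀ i, Injective (v i)) {τ : Finset X}
    (h : IsDominant v τ) (hcard : #τ + 1 = Fintype.card I) {m : I → X}
    (hmS : ∀ i, m i ∈ τ) (hm : ∀ i, ∀ s ∈ τ, v i (m i) ≤ v i s) {a b : I} (hab : a ≠ b)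
    (hmab : m a = m b) (hsurj : ∀ k, k = a ∨ k = b → ∀ s ∈ τ, ∃ l, l ≠ k ∧ m l = s) (x : X) :
    (x ∉ τ ∧ IsDominant v (insert x τ)) ↔
      ∃ k, (k = a ∨ k = b) ∧ (∀ l, l ≠ k → v l (m l) < v l x) ∧
        ∀ y, (∀ l, l ≠ k → v l (m l) < v l y) → v k y ≤ v k x := by
  constructor
  · rintro ⟨hx, hd⟩
    have hex : ∀ i, ∃ s ∈ insert x τ, ∀ s' ∈ insert x τ, v i s ≤ v i s' := fun i =>
      exists_min_image _ _ (insert_nonempty x τ)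
    choose M hMS hM using hex
    have hMsurj : ∀ s ∈ insert x τ, ∃ i, M i = s := fun s hs => hd.exists_isLeast hv hMS hM hs
    have hMinj : Injective M := by
      have := injOn_of_surjOn_of_card_le (s := (univ : Finset I)) (t := insert x τ) M
        (fun i _ => hMS i) (fun s hs => by
          obtain ⟨i, hi⟩ := hMsurj s hs
          exact ⟨i, by simp, hi⟩) (by rw [card_insert_of_notMem hx, card_univ]; omega)
      intro i j hij
      exact this (by simp) (by simp) hij
    obtain ⟨k, hk⟩ := hMsurj x (mem_insert_self _ _)
    have hMm : ∀ l, l ≠ k → M l ∈ τ ∧ M l = m l := by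
      intro l hl
      have h1 : M l ∈ τ := by
        rcases mem_insert.1 (hMS l) with h1 | h1
        · exact absurd (hMinj (h1.trans hk.symm)) hl
        · exact h1
      exact ⟨h1, hv l (le_antisymm (hM l _ (mem_insert_of_mem (hmS l))) (hm l _ h1))⟩
    refine ⟨k, ?_, ?_, ?_⟩
    · by_contra! hne
      exact hab (hMinj (by rw [(hMm a hne.1.symm).2, (hMm b hne.2.symm).2, hmab]))
    · intro l hl
      rw [← (hMm l hl).2]
      refine lt_of_le_of_ne (hM l x (mem_insert_self _ _)) fun heq => ?_
      exact hx (hv l heq ▸ (hMm l hl).1)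
    · intro y hy
      obtain ⟨i, hi⟩ := hd y
      by_cases hik : i = k
      · subst hik; exact hi x (mem_insert_self _ _)
      · exact absurd (hi _ (mem_insert_of_mem (hmS i))) (not_le.2 (hy i hik))
  · rintro ⟨k, hk, hx, hmax⟩
    refine ⟨fun hxτ => ?_, fun t => ?_⟩
    · obtain ⟨l, hl, rfl⟩ := hsurj k hk x hxτ
      exact lt_irrefl _ (hx l hl)
    · by_cases ht : ∀ l, l ≠ k → v l (m l) < v l t
      · obtain ⟨i, hi⟩ := h t
        by_cases hik : i = k
        · subst hik
          exact ⟨i, fun s hs => (mem_insert.1 hs).elim (fun e => e ▸ hmax t ht) (hi s)⟩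
        · exact absurd (hi _ (hmS i)) (not_le.2 (ht i hik))
      · push Not at ht
        obtain ⟨l, hl, hlt⟩ := ht
        refine ⟨l, fun s hs => ?_⟩
        rcases mem_insert.1 hs with rfl | hs
        · exact hlt.trans (hx l hl).le
        · exact hlt.trans (hm l s hs)

/-- If the colors of `S` do not exhaust all colors, then none or exactly two of the elements of `S`
can be removed so that precisely the colors other than `i₀` remain. -/
theorem even_card_erase_of_not_rainbow {c : X → I} {S : Finset X} (hS : #S = Fintype.card I)
    (hc : S.image c ≠ univ) (i₀ : I) :
    Even #{y ∈ S | (S.erase y).image c = univ.erase i₀} := by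
  rcases Finset.eq_empty_or_nonempty {y ∈ S | (S.erase y).image c = univ.erase i₀} with h | ⟨y, hy⟩
  · rw [h]; simp
  obtain ⟨hyS, hy⟩ := mem_filter.1 hy
  have hinj : ∀ z ∈ S, (S.erase z).image c = univ.erase i₀ → Set.InjOn c (S.erase z) := by
    intro z hz h
    rw [← card_image_iff, h, card_erase_of_mem (mem_univ _), card_erase_of_mem hz, hS, card_univ]
  have hSins : S.image c = insert (c y) (univ.erase i₀) := by
    rw [← hy, ← image_insert, insert_erase hyS]
  have hcy : c y ≠ i₀ := fun h => hc (by rw [hSins, h, insert_erase (mem_univ _)])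
  have hmem : c y ∈ (S.erase y).image c := by rw [hy]; simpa using hcy
  obtain ⟨z, hz, hzy⟩ := mem_image.1 hmem
  obtain ⟨hzne, hzS⟩ := mem_erase.1 hz
  have : ({w ∈ S | (S.erase w).image c = univ.erase i₀} : Finset X) = {y, z} := by
    ext w
    simp only [mem_filter, mem_insert, mem_singleton]
    constructor
    · rintro ⟨hwS, hw⟩
      by_contra! hne
      exact hzne (hinj w hwS hw (by simpa using ⟨hzS, hne.2.symm⟩)
        (by simpa using ⟨hyS, hne.1.symm⟩) hzy)
    · rintro (rfl | rfl)
      · exact ⟨hyS, hy⟩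
      · refine ⟨hzS, ?_⟩
        rw [← hy]
        ext i
        simp only [mem_image, mem_erase]
        constructor
        · rintro ⟨u, ⟨hu, huS⟩, rfl⟩
          by_cases huy : u = y
          · exact ⟨w, ⟨hzne, hzS⟩, by rw [huy, hzy]⟩
          · exact ⟨u, ⟨huy, huS⟩, rfl⟩
        · rintro ⟨u, ⟨hu, huS⟩, rfl⟩
          by_cases huw : u = w
          · exact ⟨y, ⟨hzne.symm, hyS⟩, by rw [huw, hzy]⟩
          · exact ⟨u, ⟨huw, huS⟩, rfl⟩
  rw [this, card_pair hzne.symm]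
  exact even_two

variable [Fintype X]

/-- A set with one element fewer than there are orders, not consisting of slack elements only, lies
in none or in exactly two dominant sets with one more element. -/
theorem even_card_dominant_insert {v : I → X → L} {e : I → X} (he : IsSlack v e) {τ : Finset X}
    (hcard : #τ + 1 = Fintype.card I) {t₀ : X} (ht₀ : t₀ ∈ τ) (hslack : ∀ k, t₀ ≠ e k) :
    Even #{x | x ∉ τ ∧ IsDominant v (insert x τ)} := by
  by_cases h : IsDominant v τ
  swap
  · rw [filter_false_of_mem]
    · simp
    · rintro x - ⟨-, hx⟩
      exact h (hx.mono (subset_insert _ _))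
  have hex : ∀ i, ∃ s ∈ τ, ∀ s' ∈ τ, v i s ≤ v i s' := fun i => exists_min_image _ _ ⟨t₀, ht₀⟩
  choose m hmS hm using hex
  obtain ⟨a, b, hab, hmab, hsurj⟩ := h.exists_pair he.inj hcard hmS hm
  -- The slack element `e k` witnesses that the set to be maximized over is nonempty.
  have hmax : ∀ k, ∃ x, (∀ l, l ≠ k → v l (m l) < v l x) ∧
        ∀ y, (∀ l, l ≠ k → v l (m l) < v l y) → v k y ≤ v k x := by
    intro k
    obtain ⟨x, hx, hx'⟩ := exists_max_image
      ({x | ∀ l, l ≠ k → v l (m l) < v l x} : Finset X) (v k)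
      ⟨e k, by
        simp only [mem_filter, mem_univ, true_and]
        exact fun l hl => (hm l t₀ ht₀).trans_lt (he.top l k t₀ hl.symm hslack)⟩
    exact ⟨x, by simpa using hx, fun y hy => hx' y (by simpa using hy)⟩
  obtain ⟨xa, hxa, hxa'⟩ := hmax a
  obtain ⟨xb, hxb, hxb'⟩ := hmax b
  have hne : xa ≠ xb := by
    rintro rfl
    obtain ⟨i, hi⟩ := h xa
    by_cases hia : i = a
    · subst hia
      exact absurd (hi _ (hmS i)) (not_le.2 (hxb i hab))
    · exact absurd (hi _ (hmS i)) (not_le.2 (hxa i hia))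
  have : ({x | x ∉ τ ∧ IsDominant v (insert x τ)} : Finset X) = {xa, xb} := by
    ext x
    rw [mem_filter, isDominant_insert_iff he.inj h hcard hmS hm hab hmab hsurj]
    simp only [mem_univ, true_and, mem_insert, mem_singleton]
    constructor
    · rintro ⟨k, rfl | rfl, h1, h2⟩
      · exact .inl (he.inj _ (le_antisymm (hxa' x h1) (h2 _ hxa)))
      · exact .inr (he.inj _ (le_antisymm (hxb' x h1) (h2 _ hxb)))
    · rintro (rfl | rfl)
      · exact ⟨a, .inl rfl, hxa, hxa'⟩
      · exact ⟨b, .inr rfl, hxb, hxb'⟩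
  rw [this, card_pair hne]
  exact even_two

/-- The slack elements other than `e i₀` lie in exactly one dominant set with one more element: the
element to add is the greatest nonslack one for `v i₀`. -/
theorem card_dominant_insert_slack {v : I → X → L} {e : I → X} (he : IsSlack v e) (i₀ : I)
    {t₀ : X} (hslack : ∀ k, t₀ ≠ e k) :
    #{x | x ∉ (univ.erase i₀).image e ∧ IsDominant v (insert x ((univ.erase i₀).image e))} = 1 := by
  obtain ⟨x₀, hx₀, hmax⟩ := exists_max_image ({x | ∀ k, x ≠ e k} : Finset X) (v i₀)
    ⟨t₀, by simpa using hslack⟩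
  simp only [mem_filter, mem_univ, true_and] at hx₀ hmax
  rw [card_eq_one]
  refine ⟨x₀, ?_⟩
  ext x
  simp only [mem_filter, mem_univ, true_and, mem_singleton]
  have hbot : ∀ i y, v i (e i) ≤ v i y := fun i y => by
    by_cases hy : y = e i
    · rw [hy]
    · exact (he.bot i y hy).le
  constructor
  · rintro ⟨hx, hd⟩
    have hlow : ∀ t, (∀ k, t ≠ e k) → v i₀ t ≤ v i₀ x := by
      intro t ht
      obtain ⟨i, hi⟩ := hd t
      by_cases hi0 : i = i₀
      · subst hi0
        exact hi x (mem_insert_self _ _)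
      · refine absurd (hi (e i) (mem_insert_of_mem (mem_image_of_mem e ?_)))
          (not_le.2 (he.bot i t (ht i)))
        simpa using hi0
    have hxs : ∀ k, x ≠ e k := by
      rintro k rfl
      by_cases hk : k = i₀
      · subst hk
        exact absurd (hlow t₀ hslack) (not_le.2 (he.bot _ _ (hslack _)))
      · exact hx (mem_image_of_mem e (by simpa using hk))
    exact he.inj i₀ (le_antisymm (hmax x hxs) (hlow x₀ hx₀))
  · rintro rfl
    refine ⟨?_, fun t => ?_⟩
    · simp only [mem_image, not_exists, not_and]
      exact fun i _ h => hx₀ i h.symm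
    · by_cases ht : ∃ k, t = e k
      · obtain ⟨k, rfl⟩ := ht
        exact ⟨k, fun s _ => hbot k s⟩
      · push Not at ht
        refine ⟨i₀, fun s hs => ?_⟩
        rcases mem_insert.1 hs with rfl | hs
        · exact hmax t ht
        · obtain ⟨j, hj, rfl⟩ := mem_image.1 hs
          exact (he.top i₀ j t (by simpa using hj) ht).le

/-- **Scarf's lemma**: if each slack element `e i` is colored `i`, some dominant set carries every
color exactly once. -/
theorem IsSlack.exists_rainbow {v : I → X → L} {e : I → X} (he : IsSlack v e) (i₀ : I)
    {t₀ : X} (hslack : ∀ k, t₀ ≠ e k) (c : X → I) (hce : ∀ i, c (e i) = i) :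
    ∃ S : Finset X, #S = Fintype.card I ∧ IsDominant v S ∧ ∀ i, ∃ s ∈ S, c s = i := by
  by_contra! hno
  let R : Finset (Finset X) := {S | #S = Fintype.card I ∧ IsDominant v S}
  let D : Finset (Finset X) := {τ | #τ + 1 = Fintype.card I ∧ τ.image c = univ.erase i₀}
  have hcount := sum_card_bipartiteAbove_eq_sum_card_bipartiteBelow
    (s := D) (t := R) (fun τ S => τ ⊆ S)
  have hI : 0 < Fintype.card I := Fintype.card_pos_iff.2 ⟨i₀⟩
  -- Each dominant set contains an even number of members of `D`.
  have heven : Even (∑ S ∈ R, #(D.bipartiteBelow (fun τ S => τ ⊆ S) S)) := by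
    refine even_sum _ fun S hS => ?_
    obtain ⟨hSc, hSd⟩ := (mem_filter.1 hS).2
    have hrain : S.image c ≠ univ := fun h => by
      obtain ⟨i, hi⟩ := hno S hSc hSd
      obtain ⟨s, hs, hsi⟩ := mem_image.1 (h ▸ mem_univ i)
      exact hi s hs hsi
    have : D.bipartiteBelow (fun τ S => τ ⊆ S) S =
        ({y ∈ S | (S.erase y).image c = univ.erase i₀} : Finset X).image S.erase := by
      ext τ
      simp only [D, bipartiteBelow, mem_filter, mem_univ, true_and, mem_image]
      constructor
      · rintro ⟨⟨hτ, hτc⟩, hτS⟩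
        obtain ⟨y, hy⟩ := card_eq_one.1
          (show #(S \ τ) = 1 by rw [card_sdiff_of_subset hτS]; omega)
        have hyS : y ∈ S \ τ := by rw [hy]; simp
        have hτe : S.erase y = τ := by
          rw [erase_eq, ← hy, Finset.sdiff_sdiff_eq_self hτS]
        exact ⟨y, ⟨(mem_sdiff.1 hyS).1, by rw [hτe, hτc]⟩, hτe⟩
      · rintro ⟨y, ⟨hyS, hy⟩, rfl⟩
        exact ⟨⟨by rw [card_erase_of_mem hyS]; omega, hy⟩, erase_subset _ _⟩
    rw [this, card_image_of_injOn]
    · exact even_card_erase_of_not_rainbow hSc hrain i₀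
    · exact (erase_injOn S).mono fun y hy => (mem_filter.1 hy).1
  -- The dominant sets above a member of `D` are obtained by adding one element.
  have habove : ∀ τ ∈ D, #(R.bipartiteAbove (fun τ S => τ ⊆ S) τ) =
      #{x | x ∉ τ ∧ IsDominant v (insert x τ)} := by
    intro τ hτ
    obtain ⟨hτ, -⟩ := (mem_filter.1 hτ).2
    have : R.bipartiteAbove (fun τ S => τ ⊆ S) τ =
        ({x | x ∉ τ ∧ IsDominant v (insert x τ)} : Finset X).image (insert · τ) := by
      ext S
      simp only [R, bipartiteAbove, mem_filter, mem_univ, true_and, mem_image]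
      constructor
      · rintro ⟨⟨hSc, hSd⟩, hτS⟩
        obtain ⟨y, hy⟩ := card_eq_one.1
          (show #(S \ τ) = 1 by rw [card_sdiff_of_subset hτS]; omega)
        have hyS : y ∈ S \ τ := by rw [hy]; simp
        have hSe : insert y τ = S := by
          rw [insert_eq, ← hy, sdiff_union_of_subset hτS]
        exact ⟨y, ⟨(mem_sdiff.1 hyS).2, by rwa [hSe]⟩, hSe⟩
      · rintro ⟨x, ⟨hx, hxd⟩, rfl⟩
        exact ⟨⟨by rw [card_insert_of_notMem hx]; omega, hxd⟩, subset_insert _ _⟩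
    rw [this, card_image_of_injOn]
    intro x hx y hy hxy
    have hx' := (mem_filter.1 hx).2.1
    have : x ∈ insert y τ := by
      rw [← show insert x τ = insert y τ from hxy]; exact mem_insert_self _ _
    exact (mem_insert.1 this).resolve_right hx'
  have hτ₀ : (univ.erase i₀).image e ∈ D := by
    simp only [D, mem_filter, mem_univ, true_and]
    refine ⟨?_, ?_⟩
    · rw [card_image_of_injective _ (LeftInverse.injective hce), card_erase_of_mem (mem_univ _),
        card_univ]
      omega
    · rw [image_image, show c ∘ e = id from funext hce, image_id]
  have hodd : Odd (∑ τ ∈ D, #(R.bipartiteAbove (fun τ S => τ ⊆ S) τ)) := by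
    rw [← add_sum_erase _ _ hτ₀, habove _ hτ₀, card_dominant_insert_slack he i₀ hslack]
    refine odd_one.add_even (even_sum _ fun τ hτ => ?_)
    obtain ⟨hne, hτ⟩ := mem_erase.1 hτ
    rw [habove _ hτ]
    obtain ⟨hτc, hτ⟩ := (mem_filter.1 hτ).2
    suffices ∃ t ∈ τ, ∀ k, t ≠ e k by
      obtain ⟨t, ht, htk⟩ := this
      exact even_card_dominant_insert he hτc ht htk
    -- A member of `D` consisting of slack elements is determined by its colors.
    by_contra! hall
    refine hne ?_
    rw [← hτ, image_image]
    refine (image_id (s := τ)).symm.trans (image_congr fun t ht => ?_)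
    obtain ⟨k, rfl⟩ := hall t ht
    simp [hce]
  rw [hcount] at hodd
  exact Nat.not_even_iff_odd.2 hodd heven

end Scarf

/-! ### Closed covers of the simplex -/

section Simplex

open Finset Metric

variable {I : Type*} [Fintype I]

/-- If finitely many continuous functions on a compact set together take values below every positive
number, one of them takes a nonpositive value. -/
theorem IsCompact.exists_le_zero_of_finite {E α : Type*} [TopologicalSpace E] [Finite α] {K : Set E}
    (hK : IsCompact K) {F : α → E → ℝ} (hF : ∀ a, ContinuousOn (F a) K)
    (h : ∀ ε > 0, ∃ a, ∃ x ∈ K, F a x < ε) : ∃ a, ∃ x ∈ K, F a x ≤ 0 := by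
  by_contra! hpos
  have hδ : ∀ a, ∃ δ > 0, ∀ x ∈ K, δ ≤ F a x := by
    intro a
    rcases K.eq_empty_or_nonempty with rfl | hne
    · exact ⟨1, one_pos, by simp⟩
    · obtain ⟨x, hx, hmin⟩ := hK.exists_isMinOn hne (hF a)
      exact ⟨F a x, hpos a x hx, fun y hy => hmin hy⟩
  choose δ hδ0 hδ using hδ
  obtain ⟨a₀, -⟩ := h 1 one_pos
  have : Nonempty α := ⟨a₀⟩
  obtain ⟨b, hb⟩ := Finite.exists_min δ
  obtain ⟨a, x, hx, hlt⟩ := h (δ b) (hδ0 b)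
  exact absurd ((hb a).trans (hδ a x hx)) (not_le.2 hlt)

/-- Scarf's lemma for finitely many points of the simplex, each colored by a coordinate: there are
points of the different colors in some set `C` such that every given point is at most all of them
in some coordinate of `C`. -/
theorem exists_colored_dominant {T : Finset (I → ℝ)} (hT : ∀ t ∈ T, t ∈ stdSimplex ℝ I)
    (hne : T.Nonempty) (c : (I → ℝ) → I) :
    ∃ C : Finset I, C.Nonempty ∧ ∃ s : I → I → ℝ, (∀ i ∈ C, s i ∈ T ∧ c (s i) = i) ∧
      ∀ t ∈ T, ∃ k ∈ C, ∀ i ∈ C, t k ≤ s i k := by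
  classical
  obtain ⟨t₀, ht₀⟩ := hne
  let X := I ⊕ T
  -- The values `-1` and `2` place the slack elements below and above all coordinates, which lie in
  -- `[0, 1]`; the second component breaks ties.
  let w : I → X → ℝ := fun i => Sum.elim (fun j => if j = i then -1 else 2) (fun t => t.1 i)
  let v : I → X → ℝ ×ₗ Fin (Fintype.card X) := fun i x => toLex (w i x, Fintype.equivFin X x)
  have hvlt : ∀ i x y, w i x < w i y → v i x < v i y := fun i x y h =>
    Prod.Lex.toLex_lt_toLex.2 (.inl h)
  have hvle : ∀ i x y, v i x ≤ v i y → w i x ≤ w i y := fun i x y h => by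
    rcases Prod.Lex.toLex_le_toLex.1 h with h | h
    · exact h.le
    · exact h.1.le
  have hw0 : ∀ i (t : T), 0 ≤ w i (.inr t) := fun i t => (hT t.1 t.2).1 i
  have hw1 : ∀ i (t : T), w i (.inr t) ≤ 1 := fun i t => by
    rw [← (hT t.1 t.2).2]
    exact single_le_sum (f := t.1) (fun j _ => (hT t.1 t.2).1 j) (mem_univ i)
  have he : IsSlack v (Sum.inl : I → X) := by
    refine ⟨fun i x y h => ?_, fun i x hx => hvlt _ _ _ ?_, fun i j x hj hx => hvlt _ _ _ ?_⟩
    · have h' : (w i x, Fintype.equivFin X x) = (w i y, Fintype.equivFin X y) := h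
      exact (Fintype.equivFin X).injective (Prod.mk.inj h').2
    · rcases x with j | t
      · have hj : j ≠ i := fun h => hx (by rw [h])
        simp only [w, Sum.elim_inl, if_pos, if_neg hj]
        norm_num
      · refine lt_of_lt_of_le ?_ (hw0 i t)
        simp [w]
    · rcases x with k | t
      · exact absurd rfl (hx k)
      · refine (hw1 i t).trans_lt ?_
        simp [w, hj]
  obtain ⟨S, -, hS, hc⟩ := he.exists_rainbow (c t₀) (t₀ := Sum.inr ⟨t₀, ht₀⟩) (by simp)
    (Sum.elim id (fun t => c t.1)) (fun i => rfl)
  have hdom : ∀ t : T, ∃ i, Sum.inl i ∉ S ∧ ∀ s ∈ S, w i (.inr t) ≤ w i s := by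
    intro t
    obtain ⟨i, hi⟩ := hS (.inr t)
    exact ⟨i, fun h => not_le.2 (he.bot i (.inr t) (by simp)) (hi _ h),
      fun s hs => hvle _ _ _ (hi s hs)⟩
  have hs : ∀ i, ∃ s : I → ℝ, Sum.inl i ∉ S → ∃ h : s ∈ T, Sum.inr ⟨s, h⟩ ∈ S ∧ c s = i := by
    intro i
    obtain ⟨x, hxS, hx⟩ := hc i
    rcases x with j | t
    · exact ⟨t₀, fun h => absurd ((show j = i from hx) ▸ hxS) h⟩
    · exact ⟨t.1, fun _ => ⟨t.2, hxS, hx⟩⟩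
  choose s hs using hs
  refine ⟨({i | Sum.inl i ∉ S} : Finset I), ?_, s, fun i hi => ?_, fun t ht => ?_⟩
  · obtain ⟨i, hi, -⟩ := hdom ⟨t₀, ht₀⟩
    exact ⟨i, by simpa using hi⟩
  · obtain ⟨h, -, h'⟩ := hs i (by simpa using hi)
    exact ⟨h, h'⟩
  · obtain ⟨k, hk, hk'⟩ := hdom ⟨t, ht⟩
    refine ⟨k, by simpa using hk, fun i hi => ?_⟩
    obtain ⟨h, h', -⟩ := hs i (by simpa using hi)
    exact hk' _ h'

/-- If every point of a `δ`-dense set is at most all `s i`, `i ∈ C`, in some coordinate of `C`, then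
the `s i` are close to each other and to the face spanned by `C`. -/
theorem close_of_dominant {T : Finset (I → ℝ)} {δ : ℝ} (hδ : 0 < δ)
    (hdense : ∀ x ∈ stdSimplex ℝ I, ∃ t ∈ T, dist x t < δ) {C : Finset I} (hC : C.Nonempty)
    {s : I → I → ℝ} (hs : ∀ i ∈ C, s i ∈ stdSimplex ℝ I)
    (hdom : ∀ t ∈ T, ∃ k ∈ C, ∀ i ∈ C, t k ≤ s i k) :
    (∀ i ∈ C, ∀ j ∈ C, dist (s i) (s j) ≤ Fintype.card I * δ) ∧
      ∀ i ∈ C, ∀ k ∉ C, s i k ≤ Fintype.card I * δ := by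
  classical
  set m : I → ℝ := fun k => if k ∈ C then C.inf' hC (fun i => s i k) else 0 with hm
  have hm0 : ∀ k, 0 ≤ m k := fun k => by
    simp only [hm]
    split_ifs
    · exact le_inf' _ _ fun i hi => (hs i hi).1 k
    · exact le_rfl
  have hms : ∀ i ∈ C, ∀ k, m k ≤ s i k := fun i hi k => by
    simp only [hm]
    split_ifs
    · exact inf'_le (fun i => s i k) hi
    · exact (hs i hi).1 k
  have hmC : ∀ k ∉ C, m k = 0 := fun k hk => by simp only [hm, if_neg hk]
  clear_value m
  have hcard : (0 : ℝ) < #C := by exact_mod_cast hC.card_pos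
  have hm1 : ∑ k, m k ≤ 1 := by
    obtain ⟨i, hi⟩ := hC
    rw [← (hs i hi).2]
    exact sum_le_sum fun k _ => hms i hi k
  -- Otherwise, distributing the defect evenly over `C` gives a point of the simplex near which no
  -- point of `T` can lie.
  have hsum : 1 - ∑ k, m k ≤ Fintype.card I * δ := by
    by_contra! hlt
    set η := (1 - ∑ k, m k) / #C with hη
    have hη0 : 0 ≤ η := div_nonneg (by linarith) hcard.le
    have hδη : δ < η := by
      rw [hη, lt_div_iff₀ hcard]
      have : (#C : ℝ) ≤ Fintype.card I := by exact_mod_cast card_le_univ C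
      nlinarith
    obtain ⟨t, ht, htd⟩ := hdense (fun k => m k + if k ∈ C then η else 0) ⟨fun k => by
        have := hm0 k
        dsimp only
        split_ifs <;> linarith, by
        rw [sum_add_distrib, sum_ite_mem, univ_inter, sum_const, nsmul_eq_mul, hη,
          mul_div_cancel₀ _ hcard.ne']
        ring⟩
    obtain ⟨k, hk, hk'⟩ := hdom t ht
    have h1 := (dist_le_pi_dist (fun k => m k + if k ∈ C then η else 0) t k).trans_lt htd
    rw [Real.dist_eq, abs_lt, if_pos hk] at h1
    have h2 : t k ≤ m k := by
      simp only [hm, if_pos hk]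
      exact le_inf' _ _ hk'
    linarith
  have hsm : ∀ i ∈ C, ∀ k, s i k - m k ≤ Fintype.card I * δ := fun i hi k => by
    refine le_trans ?_ hsum
    rw [← (hs i hi).2, ← sum_sub_distrib]
    exact single_le_sum (f := fun k => s i k - m k) (fun k _ => sub_nonneg.2 (hms i hi k))
      (mem_univ k)
  refine ⟨fun i hi j hj => ?_, fun i hi k hk => ?_⟩
  · rw [dist_pi_le_iff (by positivity)]
    intro k
    rw [Real.dist_eq, abs_le]
    have h1 := hsm i hi k
    have h2 := hsm j hj k
    have h3 := hms i hi k
    have h4 := hms j hj k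
    constructor <;> linarith
  · have := hsm i hi k
    rwa [hmC k hk, sub_zero] at this

/-- A dual form of the KKM lemma: if closed sets `A i` cover the simplex, some face contains a point
common to all `A i` indexed by its vertices. -/
theorem exists_mem_face_of_closed_cover [Nonempty I] {A : I → Set (I → ℝ)}
    (hA : ∀ i, IsClosed (A i)) (hcov : ∀ x ∈ stdSimplex ℝ I, ∃ i, x ∈ A i) :
    ∃ x ∈ stdSimplex ℝ I, ∃ C : Finset I, (∀ i ∈ C, x ∈ A i) ∧ ∀ k ∉ C, x k = 0 := by
  classical
  choose! c hc using hcov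
  let F : {C : Finset I // ∀ i ∈ C, (A i).Nonempty} → (I → ℝ) → ℝ := fun C x =>
    ∑ i, if i ∈ C.1 then infDist x (A i) else x i
  have key : ∃ C, ∃ x ∈ stdSimplex ℝ I, F C x ≤ 0 := by
    refine (isCompact_stdSimplex ℝ I).exists_le_zero_of_finite (fun C => ?_) fun ε hε => ?_
    · refine Continuous.continuousOn (continuous_finsetSum _ fun i _ => ?_)
      split_ifs
      · exact continuous_infDist_pt _
      · exact continuous_apply i
    · set n : ℝ := (Fintype.card I : ℝ)
      have hn : 0 < n := Nat.cast_pos.2 Fintype.card_pos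
      set δ := ε / (2 * n * n)
      have hδ : 0 < δ := by positivity
      obtain ⟨T, hT, hTfin, hTcov⟩ :=
        (isCompact_stdSimplex ℝ I).finite_cover_balls (e := δ) hδ
      lift T to Finset (I → ℝ) using hTfin
      have hdense : ∀ x ∈ stdSimplex ℝ I, ∃ t ∈ T, dist x t < δ := fun x hx => by
        simpa using hTcov hx
      have hTne : T.Nonempty := by
        obtain ⟨t, ht, -⟩ := hdense _ (single_mem_stdSimplex ℝ (Classical.arbitrary I))
        exact ⟨t, ht⟩
      obtain ⟨C, hC, s, hs, hdom⟩ := exists_colored_dominant (fun t ht => hT ht) hTne c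
      have hsA : ∀ i ∈ C, s i ∈ A i := fun i hi => by
        have := hc (s i) (hT (hs i hi).1)
        rwa [(hs i hi).2] at this
      obtain ⟨h1, h2⟩ := close_of_dominant hδ hdense hC (fun i hi => hT (hs i hi).1) hdom
      obtain ⟨j, hj⟩ := hC
      refine ⟨⟨C, fun i hi => ⟨s i, hsA i hi⟩⟩, s j, hT (hs j hj).1, ?_⟩
      calc _ ≤ ∑ i : I, n * δ := by
            refine sum_le_sum fun i _ => ?_
            split_ifs with hi
            · exact (infDist_le_dist_of_mem (hsA i hi)).trans (h1 j hj i hi)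
            · exact h2 j hj i hi
        _ = ε / 2 := by
            rw [sum_const, card_univ, nsmul_eq_mul]
            change n * (n * (ε / (2 * n * n))) = _
            field_simp
        _ < ε := half_lt_self hε
  obtain ⟨C, x, hx, hF⟩ := key
  have hterm : ∀ i, 0 ≤ if i ∈ C.1 then infDist x (A i) else x i := fun i => by
    split_ifs
    · exact infDist_nonneg
    · exact hx.1 i
  have hzero := (sum_eq_zero_iff_of_nonneg fun i _ => hterm i).1
    (le_antisymm hF (sum_nonneg fun i _ => hterm i))
  refine ⟨x, hx, C.1, fun i hi => ?_, fun k hk => ?_⟩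
  · have := hzero i (mem_univ i)
    rw [if_pos hi] at this
    exact ((hA i).mem_iff_infDist_zero (C.2 i hi)).2 this
  · have := hzero k (mem_univ k)
    rwa [if_neg hk] at this

end Simplex

/-! ### From matrices to systems of bijections -/

section Matching

open Finset

/-- If a nonnegative matrix with one column more than rows has row sums `1` and all column sums less
than `1`, then its rows can be matched with the columns other than any given one, along positive
entries. -/
theorem exists_equiv_pos_of_sum_lt_one {J K : Type*} [Fintype J] [Fintype K] [DecidableEq K]
    (hcard : Fintype.card K = Fintype.card J + 1) {M : J → K → ℝ} (hM : ∀ j k, 0 ≤ M j k)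
    (hrow : ∀ j, ∑ k, M j k = 1) (hcol : ∀ k, ∑ j, M j k < 1) (i : K) :
    ∃ π : J ≃ {k // k ≠ i}, ∀ j, 0 < M j (π j) := by
  classical
  let N : J → Finset K := fun j => {k | 0 < M j k}
  -- A set of rows meets more columns than it has rows, so one column can be spared.
  have hall : ∀ s : Finset J, #s ≤ #(s.biUnion fun j => (N j).erase i) := by
    intro s
    have herase : s.biUnion (fun j => (N j).erase i) = (s.biUnion N).erase i := by
      ext k
      simp only [mem_biUnion, mem_erase]
      tauto
    rcases s.eq_empty_or_nonempty with rfl | ⟨j₀, hj₀⟩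
    · simp
    have hone : ∀ j ∈ s, ∑ k ∈ s.biUnion N, M j k = 1 := fun j hj => by
      rw [← hrow j]
      refine sum_subset (subset_univ _) fun k _ hk => ?_
      by_contra hne
      exact hk (mem_biUnion.2 ⟨j, hj, by simpa [N] using lt_of_le_of_ne (hM j k) (Ne.symm hne)⟩)
    have hne : (s.biUnion N).Nonempty := by
      by_contra h
      have := hone j₀ hj₀
      rw [not_nonempty_iff_eq_empty.1 h] at this
      simp at this
    have hlt : (#s : ℝ) < #(s.biUnion N) := by
      calc (#s : ℝ) = ∑ j ∈ s, ∑ k ∈ s.biUnion N, M j k := by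
            rw [sum_congr rfl hone]; simp
        _ = ∑ k ∈ s.biUnion N, ∑ j ∈ s, M j k := sum_comm
        _ ≤ ∑ k ∈ s.biUnion N, ∑ j, M j k := sum_le_sum fun k _ =>
            sum_le_sum_of_subset_of_nonneg (subset_univ _) fun j _ _ => hM j k
        _ < ∑ k ∈ s.biUnion N, 1 := sum_lt_sum_of_nonempty hne fun k _ => hcol k
        _ = #(s.biUnion N) := by simp
    have hlt' : #s < #(s.biUnion N) := by exact_mod_cast hlt
    have := pred_card_le_card_erase (s := s.biUnion N) (a := i)
    rw [herase]
    omega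
  obtain ⟨f, hfinj, hf⟩ := (all_card_le_biUnion_card_iff_exists_injective _).1 hall
  have hf' : ∀ j, f j ≠ i ∧ 0 < M j (f j) := fun j => by simpa [N] using hf j
  let g : J → {k // k ≠ i} := fun j => ⟨f j, (hf' j).1⟩
  have hg : Function.Bijective g := by
    rw [Fintype.bijective_iff_injective_and_card]
    refine ⟨fun a b h => hfinj (congrArg Subtype.val h), ?_⟩
    rw [Fintype.card_subtype_compl, Fintype.card_subtype_eq, hcard]
    rfl
  exact ⟨Equiv.ofBijective g hg, fun j => (hf' j).2⟩

end Matching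

/-! ### KKM covers -/

section KKM

open Finset Metric

variable {d : ℕ}

theorem IsKKMCover.nonempty {C : Fin (d + 1) → Set (Fin (d + 1) → ℝ)} (hC : IsKKMCover C)
    (k : Fin (d + 1)) : (C k).Nonempty := by
  have h : Pi.single k (1 : ℝ) ∈ simplexFace d {k} :=
    ⟨single_mem_stdSimplex ℝ k, fun i hi => Pi.single_eq_of_ne hi 1⟩
  have := hC.face_subset _ h
  simp only [Set.mem_singleton_iff, Set.iUnion_iUnion_eq_left] at this
  exact ⟨_, this⟩

/-- A KKM cover can be replaced by continuous functions that map the simplex to itself, preserve its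
faces, and whose `k`-th coordinate is supported near `C k`. -/
theorem IsKKMCover.exists_partition {C : Fin (d + 1) → Set (Fin (d + 1) → ℝ)} (hC : IsKKMCover C)
    {ε : ℝ} (hε : 0 < ε) : ∃ f : (Fin (d + 1) → ℝ) → Fin (d + 1) → ℝ,
      (∀ k, ContinuousOn (fun x => f x k) (stdSimplex ℝ (Fin (d + 1)))) ∧
      ∀ x ∈ stdSimplex ℝ (Fin (d + 1)), f x ∈ stdSimplex ℝ (Fin (d + 1)) ∧
        ∀ k, (x k = 0 → f x k = 0) ∧ (0 < f x k → infDist x (C k) < ε) := by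
  -- The factor `x k` makes the functions face-preserving. It does not harm positivity of the sum,
  -- as `x` lies in some `C k` with `x k ≠ 0`.
  let h : Fin (d + 1) → (Fin (d + 1) → ℝ) → ℝ := fun k x => x k * max 0 (ε - infDist x (C k))
  have hcont : ∀ k, Continuous (h k) := fun k =>
    (continuous_apply k).mul (continuous_const.max (continuous_const.sub (continuous_infDist_pt _)))
  have h0 : ∀ x ∈ stdSimplex ℝ (Fin (d + 1)), ∀ k, 0 ≤ h k x := fun x hx k =>
    mul_nonneg (hx.1 k) (le_max_left _ _)
  have hpos : ∀ x ∈ stdSimplex ℝ (Fin (d + 1)), 0 < ∑ k, h k x := by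
    intro x hx
    have hx' : x ∈ ⋃ i ∈ {i | x i ≠ 0}, C i := hC.face_subset _ ⟨hx, fun i hi => by simpa using hi⟩
    simp only [Set.mem_iUnion] at hx'
    obtain ⟨k, hk, hxk⟩ := hx'
    refine sum_pos' (fun k _ => h0 x hx k) ⟨k, mem_univ k, ?_⟩
    refine mul_pos (lt_of_le_of_ne (hx.1 k) (Ne.symm hk)) ?_
    rw [infDist_zero_of_mem hxk, sub_zero]
    exact lt_max_of_lt_right hε
  refine ⟨fun x k => h k x / ∑ k, h k x, fun k => ?_, fun x hx => ⟨⟨fun k => ?_, ?_⟩, fun k => ?_⟩⟩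
  · exact (hcont k).continuousOn.div (continuous_finsetSum _ fun k _ => hcont k).continuousOn
      fun x hx => (hpos x hx).ne'
  · exact div_nonneg (h0 x hx k) (hpos x hx).le
  · rw [← sum_div, div_self (hpos x hx).ne']
  · refine ⟨fun hk => by simp [h, hk], fun hk => ?_⟩
    by_contra! hle
    have : h k x = 0 := by
      simp only [h]
      rw [max_eq_left (by linarith), mul_zero]
    simp [this] at hk

/-- For every `ε`, some point has distance less than `ε` to all the sets selected by suitable
bijections. -/
theorem exists_approx_equiv {C : Fin d → Fin (d + 1) → Set (Fin (d + 1) → ℝ)}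
    (hC : ∀ j, IsKKMCover (C j)) {ε : ℝ} (hε : 0 < ε) :
    ∃ x ∈ stdSimplex ℝ (Fin (d + 1)),
      ∃ π : (i : Fin (d + 1)) → (Fin d ≃ {k : Fin (d + 1) // k ≠ i}),
        ∀ i j, infDist x (C j (π i j)) < ε := by
  choose f hcont hf using fun j => (hC j).exists_partition hε
  let A : Fin (d + 1) → Set (Fin (d + 1) → ℝ) := fun k =>
    {x ∈ stdSimplex ℝ (Fin (d + 1)) | ∑ j, f j x k ≤ d / (d + 1)}
  have hA : ∀ k, IsClosed (A k) := fun k =>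
    (continuousOn_finsetSum univ fun j _ => hcont j k).preimage_isClosed_of_isClosed
      (isClosed_stdSimplex ℝ _) isClosed_Iic
  -- The `d + 1` column sums add up to `d`, so one of them is at most the average.
  have hcov : ∀ x ∈ stdSimplex ℝ (Fin (d + 1)), ∃ k, x ∈ A k := by
    intro x hx
    by_contra! hno
    have hlt : ∑ _k : Fin (d + 1), (d : ℝ) / (d + 1) < ∑ k, ∑ j, f j x k :=
      sum_lt_sum_of_nonempty univ_nonempty fun k _ => by
        by_contra! hle
        exact hno k ⟨hx, hle⟩
    rw [sum_comm, sum_congr rfl fun j _ => (hf j x hx).1.2] at hlt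
    simp only [sum_const, card_univ, Fintype.card_fin, nsmul_eq_mul, mul_one] at hlt
    push_cast at hlt
    rw [mul_div_cancel₀ _ (by positivity)] at hlt
    exact lt_irrefl _ hlt
  obtain ⟨x, hx, S, hS, hS0⟩ := exists_mem_face_of_closed_cover hA hcov
  have hcol : ∀ k, ∑ j, f j x k < 1 := by
    intro k
    by_cases hk : k ∈ S
    · refine (hS k hk).2.trans_lt ?_
      rw [div_lt_one (by positivity)]
      linarith
    · rw [sum_eq_zero fun j _ => ((hf j x hx).2 k).1 (hS0 k hk)]
      exact one_pos
  choose π hπ using exists_equiv_pos_of_sum_lt_one (by simp) (fun j k => (hf j x hx).1.1 k)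
    (fun j => (hf j x hx).1.2) hcol
  exact ⟨x, hx, π, fun i j => ((hf j x hx).2 _).2 (hπ i j)⟩

end KKM

theorem mainTheorem4 (d : ℕ) (C : Fin d → Fin (d + 1) → Set (Fin (d + 1) → ℝ))
    (hC : ∀ j, IsKKMCover (C j)) :
    ∃ x ∈ stdSimplex ℝ (Fin (d + 1)),
      ∃ π : (i : Fin (d + 1)) → (Fin d ≃ {k : Fin (d + 1) // k ≠ i}),
        ∀ i : Fin (d + 1), x ∈ ⋂ j : Fin d, C j (π i j) := by
  let F : ((i : Fin (d + 1)) → (Fin d ≃ {k : Fin (d + 1) // k ≠ i})) → (Fin (d + 1) → ℝ) → ℝ :=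
    fun π x => ∑ i, ∑ j, Metric.infDist x (C j (π i j))
  have hF : ∀ π, Continuous (F π) := fun π =>
    continuous_finsetSum _ fun i _ => continuous_finsetSum _ fun j _ =>
      Metric.continuous_infDist_pt _
  obtain ⟨π, x, hx, hle⟩ := (isCompact_stdSimplex ℝ (Fin (d + 1))).exists_le_zero_of_finite
    (fun π => (hF π).continuousOn) fun ε hε => by
      obtain ⟨x, hx, π, hπ⟩ := exists_approx_equiv hC
        (show 0 < ε / ((d + 1) * (d + 1)) by positivity)
      refine ⟨π, x, hx, ?_⟩
      calc F π x ≤ ∑ _i : Fin (d + 1), ∑ _j : Fin d, ε / ((d + 1) * (d + 1)) :=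
            Finset.sum_le_sum fun i _ => Finset.sum_le_sum fun j _ => (hπ i j).le
        _ = ε * (d / (d + 1)) := by
            simp only [Finset.sum_const, Finset.card_univ, Fintype.card_fin, nsmul_eq_mul]
            push_cast
            field_simp
        _ < ε := mul_lt_of_lt_one_right hε ((div_lt_one (by positivity)).2 (by linarith))
  refine ⟨x, hx, π, fun i => Set.mem_iInter.2 fun j => ?_⟩
  rw [((hC j).isClosed _).mem_iff_infDist_zero ((hC j).nonempty _)]
  refine le_antisymm (le_trans ?_ hle) Metric.infDist_nonneg
  refine le_trans ?_ (Finset.single_le_sum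
    (f := fun i => ∑ j, Metric.infDist x (C j (π i j)))
    (fun i _ => Finset.sum_nonneg fun j _ => Metric.infDist_nonneg) (Finset.mem_univ i))
  exact Finset.single_le_sum (f := fun j => Metric.infDist x (C j (π i j)))
    (fun j _ => Metric.infDist_nonneg) (Finset.mem_univ j)
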